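/- Let $M_{22}$ be the Mathieu group of order $443520$ in its action on a set $\Omega$ of $22$ points. By a design with block size $k$ we mean a non-empty set $\mathcal B$ of $k$-element subsets (blocks) of $\Omega$ such that, for some $t$ with $1\le t\le k$ and some $\lambda_t$, every $t$ distinct points lie together in exactly $\lambda_t$ blocks. It is $M_{22}$-invariant if $M_{22}$ maps $\mathcal B$ to itself, and block-transitive if moreover $M_{22}$ acts transitively on $\mathcal B$. Let $b$ be the number of blocks, $r$ the number of blocks through a point, and $\lambda$ the number of blocks through three distinct points. (1) Every block-transitive $M_{22}$-invariant design with block size $4\le k\le 11$ is a $3$-$(22,k,\lambda)$ design, and its parameters $(b,r,k,\lambda)$ are one of the following: - $k=4$: $(1155,210,4,3)$, $(6160,1120,4,16)$; - $k=5$: $(462,105,5,3)$, $(3696,840,5,24)$, $(18480,4200,5,120)$; - $k=6$: $(77,21,6,1)$, $(1232,336,6,16)$, $(7392,2016,6,96)$, $(9240,2520,6,120)$, $(55440,15120,6,720)$; - $k=7$: $(176,56,7,4)$, $(1232,392,7,28)$, $(2640,840,7,60)$, $(18480,5880,7,420)$, $(55440,17640,7,1260)$, $(73920,23520,7,1680)$;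 - $k=8$: $(330,120,8,12)$, $(2640,960,8,96)$, $(9240,3360,8,336)$, $(27720,10080,8,1008)$, $(36960,13440,8,1344)$, $(55440,20160,8,2016)$, $(73920,26880,8,2688)$; - $k=9$: $(4620,1890,9,252)$, $(6160,2520,9,336)$, $(18480,7560,9,1008)$, $(24640,10080,9,1344)$, $(36960,15120,9,2016)$, $(110880,45360,9,6048)$, $(221760,90720,9,12096)$; - $k=10$: $(616,280,10,48)$, $(2310,1050,10,180)$, $(6160,2800,10,480)$, $(7392,3360,10,576)$, $(18480,8400,10,1440)$, $(22176,10080,10,1728)$, $(27720,12600,10,2160)$, $(73920,33600,10,5760)$, $(110880,50400,10,8640)$, $(221760,100800,10,17280)$; - $k=11$: $(672,336,11,72)$, $(7392,3696,11,792)$, $(9240,4620,11,990)$, $(27720,13860,11,2970)$, $(36960,18480,11,3960)$, $(44352,22176,11,4752)$, $(73920,36960,11,7920)$, $(110880,55440,11,11880)$. (2) Each of these parameter sets is realised by a block-transitive $M_{22}$-invariant $3$-design. (3) For $12\le k\le 18$, the block-transitive $M_{22}$-invariant designs with block size $k$ are exactly the complements $\{\Omega\setminus X : X\in\mathcal B\}$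 of the block-transitive $M_{22}$-invariant designs $\mathcal B$ with block size $22-k$, which have parameters in the list above. For $19\le k\le 22$ the only block-transitive $M_{22}$-invariant design with block size $k$ is the complete design, whose blocks are all $k$-subsets of $\Omega$. -/

import Mathlib

open scoped Pointwise

/-- First standard generator of `M₂₂` in its action of degree 22 (an involution).
The points `1, …, 22` are written as residues modulo 22, so that the point 22 is `0 : Fin 22`. -/
def mathieu22GenA : Equiv.Perm (Fin 22) :=
  c[1, 13] * c[2, 8] * c[3, 16] * c[4, 12] * c[6, 0] * c[7, 17] * c[9, 10] * c[11, 14]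

/-- Second standard generator of `M₂₂` in its action of degree 22 (an element of order 4;
the product of the two generators has order 11). -/
def mathieu22GenB : Equiv.Perm (Fin 22) :=
  c[1, 0, 3, 21] * c[2, 18, 4, 13] * c[5, 12] * c[6, 11, 7, 15] * c[8, 14, 20, 10] * c[17, 19]

/-- The Mathieu group `M₂₂` as a permutation group of degree 22, generated by the standard
generators of the ATLAS of Group Representations. It has order 443520. -/
def mathieu22 : Subgroup (Equiv.Perm (Fin 22)) :=
  Subgroup.closure {mathieu22GenA, mathieu22GenB}

section Designs

variable {Ω : Type*} [DecidableEq Ω]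

/-- The subsets in `B` are the blocks of a `t`-`(v, k, lam)` design on the point set `Ω`
(`v = |Ω|`, `t` positive): all blocks have `k` points, and every `t` distinct points lie
together in exactly `lam` blocks. -/
structure IsTDesign (t k lam : ℕ) (B : Finset (Finset Ω)) : Prop where
  t_pos : 1 ≤ t
  card_block : ∀ X ∈ B, X.card = k
  card_through : ∀ T : Finset Ω, T.card = t → (B.filter (fun X => T ⊆ X)).card = lam

/-- The automorphism group of the design with block set `B`: the permutations of the points
that map the block set onto itself. -/
def designAut (B : Finset (Finset Ω)) : Subgroup (Equiv.Perm Ω) :=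
  MulAction.stabilizer (Equiv.Perm Ω) B

/-- `B` is the (non-empty) block set of a block-transitive `G`-invariant design with block
size `k`: it is a `t`-design for some positive `t ≤ k`, `G` is contained in its automorphism
group, and `G` acts transitively on the blocks. -/
structure IsBlockTransitiveDesign (G : Subgroup (Equiv.Perm Ω)) (k : ℕ)
    (B : Finset (Finset Ω)) : Prop where
  nonempty : B.Nonempty
  isDesign : ∃ t lam : ℕ, t ≤ k ∧ IsTDesign t k lam B
  invariant : G ≤ designAut B
  transitive : ∀ X ∈ B, ∀ Y ∈ B, ∃ g ∈ G, g • X = Y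

/-- The design with block set `B` is a `3`-design with `b` blocks, `r` blocks through each
point, block size `k`, and `lam` blocks through any three distinct points. -/
structure IsThreeDesignWith (b r k lam : ℕ) (B : Finset (Finset Ω)) : Prop where
  card_blocks : B.card = b
  replication : ∀ x : Ω, (B.filter (fun X => x ∈ X)).card = r
  isDesign : IsTDesign 3 k lam B

/-- The complement of a design: its blocks are the complements of the blocks. -/
def complementDesign [Fintype Ω] (B : Finset (Finset Ω)) : Finset (Finset Ω) :=
  B.image (fun X => Xᶜ)

end Designs

/-- The table of parameters `(b, r, k, λ)`. -/
def designTable : List (ℕ × ℕ × ℕ × ℕ) :=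
  [(1155, 210, 4, 3), (6160, 1120, 4, 16),
   (462, 105, 5, 3), (3696, 840, 5, 24), (18480, 4200, 5, 120),
   (77, 21, 6, 1), (1232, 336, 6, 16), (7392, 2016, 6, 96), (9240, 2520, 6, 120),
   (55440, 15120, 6, 720),
   (176, 56, 7, 4), (1232, 392, 7, 28), (2640, 840, 7, 60), (18480, 5880, 7, 420),
   (55440, 17640, 7, 1260), (73920, 23520, 7, 1680),
   (330, 120, 8, 12), (2640, 960, 8, 96), (9240, 3360, 8, 336), (27720, 10080, 8, 1008),
   (36960, 13440, 8, 1344), (55440, 20160, 8, 2016), (73920, 26880, 8, 2688),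
   (4620, 1890, 9, 252), (6160, 2520, 9, 336), (18480, 7560, 9, 1008),
   (24640, 10080, 9, 1344), (36960, 15120, 9, 2016), (110880, 45360, 9, 6048),
   (221760, 90720, 9, 12096),
   (616, 280, 10, 48), (2310, 1050, 10, 180), (6160, 2800, 10, 480), (7392, 3360, 10, 576),
   (18480, 8400, 10, 1440), (22176, 10080, 10, 1728), (27720, 12600, 10, 2160),
   (73920, 33600, 10, 5760), (110880, 50400, 10, 8640), (221760, 100800, 10, 17280),
   (672, 336, 11, 72), (7392, 3696, 11, 792), (9240, 4620, 11, 990),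
   (27720, 13860, 11, 2970), (36960, 18480, 11, 3960), (44352, 22176, 11, 4752),
   (73920, 36960, 11, 7920), (110880, 55440, 11, 11880)]

/-!
The table of orbit representatives below has one representative on `t`-subsets for each `t ≤ 3`, so
`M₂₂` is transitive on 3-subsets. Hence every `M₂₂`-invariant family of `k`-subsets with `k ≥ 3` is
a 3-design, and the block-transitive designs are exactly the orbits of `M₂₂` on `k`-subsets
(`isBlockTransitiveDesign_iff`). Counting incidences gives `r` and `λ` from the number `b` of
blocks (`isThreeDesignWith_subsetOrbit`), and complementation reduces `k ≥ 12` to `k ≤ 10`. What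
remains is to find the lengths of the orbits on `k`-subsets for `k ≤ 11`.

They are found by induction on `k`, from a table of representatives `orbitReps k`, without using
the order of `M₂₂` or any stabilizer:

* every `k`-subset is equivalent to a representative: it suffices to adjoin a point `p` to each
  representative `X` of the orbits on `(k - 1)`-subsets, and the table has a word in the generators
  that moves `X ∪ {p}` to a representative (`extension_eq`);
* different representatives are inequivalent: `M₂₂` permutes a class of 176 heptads, and the sum
  over these heptads `h` of `|h ∩ X| ^ 8` is an invariant that takes different values on the
  representatives (`orbitReps_separated`);
* if `X` runs through the representatives of the orbits on `(k - 1)`-subsets and `Z` is a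
  `k`-subset, then counting the pairs `Y ⊂ Z'` with `|Y| = k - 1` and `Z'` in the orbit of `Z` gives
  `k * |Z^G| = ∑ X, |X^G| * #{p ∉ X | X ∪ {p} ∈ Z^G}`
  (`IsOrbitTransversal.card_subsetOrbit_mul`), and the numbers on the right are known by the two
  previous items.

The finite checks are evaluated by the kernel on subsets encoded as bit masks.
-/

open Finset

/-! ### Orbits of a permutation group on subsets -/

section Orbits

variable {Ω : Type*} [Fintype Ω] [DecidableEq Ω] {G : Subgroup (Equiv.Perm Ω)}

open scoped Classical in
/-- The images of the subset `X` under the permutation group `G`, as a finite set of subsets. -/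
noncomputable def subsetOrbit (G : Subgroup (Equiv.Perm Ω)) (X : Finset Ω) : Finset (Finset Ω) :=
  univ.filter fun Y => ∃ g ∈ G, g • X = Y

theorem mem_subsetOrbit {X Y : Finset Ω} : Y ∈ subsetOrbit G X ↔ ∃ g ∈ G, g • X = Y := by
  simp [subsetOrbit]

theorem mem_subsetOrbit_self (X : Finset Ω) : X ∈ subsetOrbit G X :=
  mem_subsetOrbit.2 ⟨1, G.one_mem, one_smul _ _⟩

theorem subsetOrbit_eq_of_mem {X Y : Finset Ω} (h : Y ∈ subsetOrbit G X) :
    subsetOrbit G Y = subsetOrbit G X := by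
  obtain ⟨g, hg, rfl⟩ := mem_subsetOrbit.1 h
  ext Z
  simp only [mem_subsetOrbit]
  constructor
  · rintro ⟨a, ha, rfl⟩
    exact ⟨a * g, G.mul_mem ha hg, mul_smul _ _ _⟩
  · rintro ⟨a, ha, rfl⟩
    exact ⟨a * g⁻¹, G.mul_mem ha (G.inv_mem hg), by rw [mul_smul, inv_smul_smul]⟩

theorem smul_mem_subsetOrbit_iff {g : Equiv.Perm Ω} (hg : g ∈ G) {X Y : Finset Ω} :
    g • Y ∈ subsetOrbit G X ↔ Y ∈ subsetOrbit G X := by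
  simp only [mem_subsetOrbit]
  constructor
  · rintro ⟨a, ha, h⟩
    exact ⟨g⁻¹ * a, G.mul_mem (G.inv_mem hg) ha, by rw [mul_smul, h, inv_smul_smul]⟩
  · rintro ⟨a, ha, rfl⟩
    exact ⟨g * a, G.mul_mem hg ha, mul_smul _ _ _⟩

theorem card_of_mem_subsetOrbit {X Y : Finset Ω} (h : Y ∈ subsetOrbit G X) : Y.card = X.card := by
  obtain ⟨g, -, rfl⟩ := mem_subsetOrbit.1 h
  exact card_smul_finset g X

/-- The subset orbit is stable under the group. -/
theorem le_designAut_subsetOrbit (X : Finset Ω) : G ≤ designAut (subsetOrbit G X) := by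
  intro g hg
  rw [designAut, MulAction.mem_stabilizer_iff]
  refine eq_of_subset_of_card_le ?_ (card_smul_finset _ _).ge
  intro Y hY
  obtain ⟨Z, hZ, rfl⟩ := mem_smul_finset.1 hY
  exact (smul_mem_subsetOrbit_iff hg).2 hZ

/-- The list `R` represents every `G`-orbit of `k`-subsets exactly once. -/
structure IsOrbitTransversal (G : Subgroup (Equiv.Perm Ω)) (k : ℕ) (R : List (Finset Ω)) :
    Prop where
  nodup : R.Nodup
  card_eq : ∀ X ∈ R, X.card = k
  exists_mem : ∀ Y : Finset Ω, Y.card = k → ∃ X ∈ R, Y ∈ subsetOrbit G X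
  eq_of_mem : ∀ X ∈ R, ∀ Y ∈ R, Y ∈ subsetOrbit G X → X = Y

namespace IsOrbitTransversal

variable {k : ℕ} {R : List (Finset Ω)}

/-- A sum over all `k`-subsets of a `G`-invariant function, computed orbit by orbit. -/
theorem sum_powersetCard (hR : IsOrbitTransversal G k R) (F : Finset Ω → ℕ)
    (hF : ∀ g ∈ G, ∀ X, F (g • X) = F X) :
    ∑ Y ∈ powersetCard k univ, F Y = (R.map fun X => (subsetOrbit G X).card * F X).sum := by
  have hU : powersetCard k univ = R.toFinset.biUnion (subsetOrbit G) := by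
    ext Y
    simp only [mem_powersetCard, subset_univ, true_and, mem_biUnion, List.mem_toFinset]
    refine ⟨hR.exists_mem Y, ?_⟩
    rintro ⟨X, hX, hY⟩
    rw [card_of_mem_subsetOrbit hY, hR.card_eq X hX]
  rw [hU, sum_biUnion, List.sum_toFinset _ hR.nodup]
  · congr 1
    refine List.map_congr_left fun X _ => ?_
    rw [sum_const_nat]
    intro Y hY
    obtain ⟨g, hg, rfl⟩ := mem_subsetOrbit.1 hY
    exact hF g hg X
  · intro X hX Y hY hne
    refine disjoint_left.2 fun Z hZX hZY => hne ?_
    refine hR.eq_of_mem X (by simpa using hX) Y (by simpa using hY) ?_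
    rw [← subsetOrbit_eq_of_mem hZX, subsetOrbit_eq_of_mem hZY]
    exact mem_subsetOrbit_self Y

/-- The length of the orbit of a `(k + 1)`-subset `Z`, from the lengths of the orbits of
`k`-subsets: both sides count the pairs `Y ⊂ X` with `|Y| = k` and `X` in the orbit of `Z`. -/
theorem card_subsetOrbit_mul (hR : IsOrbitTransversal G k R) {Z : Finset Ω}
    (hZ : Z.card = k + 1) :
    (subsetOrbit G Z).card * (k + 1) = (R.map fun X => (subsetOrbit G X).card *
      (univ.filter fun p => p ∉ X ∧ insert p X ∈ subsetOrbit G Z).card).sum := by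
  rw [← hR.sum_powersetCard
    fun X => (univ.filter fun p => p ∉ X ∧ insert p X ∈ subsetOrbit G Z).card]
  · have h := sum_card_bipartiteAbove_eq_sum_card_bipartiteBelow
      (s := powersetCard k (univ : Finset Ω)) (t := subsetOrbit G Z) (fun Y X => Y ⊆ X)
    have h1 : ∀ X ∈ subsetOrbit G Z,
        (bipartiteBelow (fun Y X => Y ⊆ X) (powersetCard k (univ : Finset Ω)) X).card = k + 1 := by
      intro X hX
      have : bipartiteBelow (fun Y X => Y ⊆ X) (powersetCard k (univ : Finset Ω)) X
          = powersetCard k X := by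
        ext Y
        simp [mem_bipartiteBelow, mem_powersetCard, and_comm]
      rw [this, card_powersetCard, card_of_mem_subsetOrbit hX, hZ, Nat.choose_succ_self_right]
    rw [sum_const_nat h1] at h
    rw [← h]
    refine sum_congr rfl fun Y hY => ?_
    have hYc : Y.card = k := (mem_powersetCard.1 hY).2
    symm
    refine card_bij (fun p _ => insert p Y) ?_ ?_ ?_
    · intro p hp
      rw [mem_filter] at hp
      exact (mem_bipartiteAbove _).2 ⟨hp.2.2, subset_insert _ _⟩
    · intro p hp q _ hpq
      rw [mem_filter] at hp
      have : p ∈ insert q Y := hpq ▸ mem_insert_self p Y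
      exact (mem_insert.1 this).resolve_right hp.2.1
    · intro X hX
      obtain ⟨hX, hYX⟩ := (mem_bipartiteAbove _).1 hX
      have hXc : X.card = Y.card + 1 := by rw [card_of_mem_subsetOrbit hX, hZ, hYc]
      have hd : (X \ Y).card = 1 := by rw [card_sdiff_of_subset hYX]; omega
      obtain ⟨p, hp⟩ := card_eq_one.1 hd
      have hpX : p ∈ X \ Y := hp ▸ mem_singleton_self p
      have : insert p Y = X := by
        rw [insert_eq, ← hp, sdiff_union_of_subset hYX]
      exact ⟨p, by simp [this, hX, (mem_sdiff.1 hpX).2], this⟩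
  · intro g hg X
    symm
    refine card_bij (fun p _ => g p) ?_ (fun _ _ _ _ h => g.injective h) ?_
    · intro p hp
      rw [mem_filter] at hp ⊢
      refine ⟨mem_univ _, ?_, ?_⟩
      · exact fun h => hp.2.1 ((smul_mem_smul_finset_iff g).1 h)
      · have := (smul_mem_subsetOrbit_iff hg).2 hp.2.2
        rwa [smul_finset_insert] at this
    · intro q hq
      rw [mem_filter] at hq
      refine ⟨g⁻¹ q, ?_, by simp⟩
      rw [mem_filter]
      refine ⟨mem_univ _, ?_, ?_⟩
      · exact fun h => hq.2.1 (mem_smul_finset.2 ⟨_, h, by simp⟩)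
      · rw [← smul_mem_subsetOrbit_iff hg, smul_finset_insert]
        simpa using hq.2.2

end IsOrbitTransversal

/-! ### Designs from groups transitive on `t`-subsets -/

/-- If `G` is transitive on `t`-subsets, then every `G`-invariant family of `k`-subsets is a
`t`-design; its index comes from counting the pairs of a `t`-subset and a block containing it. -/
theorem isTDesign_of_transitive {t k : ℕ} (ht : 1 ≤ t) {T₀ : Finset Ω}
    (htrans : ∀ T : Finset Ω, T.card = t → T ∈ subsetOrbit G T₀) {B : Finset (Finset Ω)}
    (hB : G ≤ designAut B) (hk : ∀ X ∈ B, X.card = k) :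
    ∃ lam : ℕ, IsTDesign t k lam B ∧
      lam * (Fintype.card Ω).choose t = B.card * k.choose t := by
  have hc : ∀ T : Finset Ω, T.card = t →
      (B.filter fun X => T ⊆ X).card = (B.filter fun X => T₀ ⊆ X).card := by
    intro T hT
    obtain ⟨g, hg, rfl⟩ := mem_subsetOrbit.1 (htrans T hT)
    have hgB : g • B = B := MulAction.mem_stabilizer_iff.1 (hB hg)
    rw [← card_smul_finset g (B.filter fun X => T₀ ⊆ X)]
    congr 1
    ext X
    rw [mem_filter, mem_smul_finset]
    constructor
    · rintro ⟨hX, hTX⟩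
      rw [← hgB] at hX
      obtain ⟨Y, hY, rfl⟩ := mem_smul_finset.1 hX
      exact ⟨Y, mem_filter.2 ⟨hY, smul_finset_subset_smul_finset_iff.1 hTX⟩, rfl⟩
    · rintro ⟨Y, hY, rfl⟩
      rw [mem_filter] at hY
      refine ⟨?_, smul_finset_subset_smul_finset_iff.2 hY.2⟩
      rw [← hgB]
      exact smul_mem_smul_finset hY.1
  refine ⟨_, ⟨ht, hk, hc⟩, ?_⟩
  have h := sum_card_bipartiteAbove_eq_sum_card_bipartiteBelow
    (s := powersetCard t (univ : Finset Ω)) (t := B) (fun T X => T ⊆ X)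
  rw [sum_const_nat (m := (B.filter fun X => T₀ ⊆ X).card), sum_const_nat (m := k.choose t),
    card_powersetCard, card_univ] at h
  · rw [← h, mul_comm]
  · intro X hX
    rw [← hk X hX, ← card_powersetCard]
    congr 1
    ext T
    simp [mem_bipartiteBelow, mem_powersetCard, and_comm]
  · intro T hT
    exact hc T (mem_powersetCard.1 hT).2

/-- A block-transitive design is a single orbit. -/
theorem IsBlockTransitiveDesign.exists_eq_subsetOrbit {k : ℕ} {B : Finset (Finset Ω)}
    (h : IsBlockTransitiveDesign G k B) :
    ∃ X : Finset Ω, X.card = k ∧ B = subsetOrbit G X := by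
  obtain ⟨X, hX⟩ := h.nonempty
  obtain ⟨t, lam, -, hd⟩ := h.isDesign
  refine ⟨X, hd.card_block X hX, ?_⟩
  ext Y
  rw [mem_subsetOrbit]
  refine ⟨h.transitive X hX Y, ?_⟩
  rintro ⟨g, hg, rfl⟩
  rw [← MulAction.mem_stabilizer_iff.1 (h.invariant hg)]
  exact smul_mem_smul_finset hX

/-- If `G` is transitive on `t`-subsets, then all orbits of `k`-subsets with `k ≥ t` are
block-transitive designs. -/
theorem isBlockTransitiveDesign_subsetOrbit {t : ℕ} (ht : 1 ≤ t) {T₀ : Finset Ω}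
    (htrans : ∀ T : Finset Ω, T.card = t → T ∈ subsetOrbit G T₀)
    {X : Finset Ω} (hX : t ≤ X.card) :
    IsBlockTransitiveDesign G X.card (subsetOrbit G X) := by
  obtain ⟨lam, hlam, -⟩ := isTDesign_of_transitive ht htrans
    (le_designAut_subsetOrbit X) (fun Y hY => card_of_mem_subsetOrbit hY)
  refine ⟨⟨X, mem_subsetOrbit_self X⟩, ⟨t, lam, hX, hlam⟩, le_designAut_subsetOrbit X, ?_⟩
  intro Y hY Z hZ
  rw [← subsetOrbit_eq_of_mem hY] at hZ
  exact mem_subsetOrbit.1 hZ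

theorem smul_compl (g : Equiv.Perm Ω) (X : Finset Ω) : g • Xᶜ = (g • X)ᶜ := by
  apply coe_injective
  simp [Set.smul_set_compl]

theorem complementDesign_subsetOrbit (X : Finset Ω) :
    complementDesign (subsetOrbit G X) = subsetOrbit G Xᶜ := by
  ext Y
  simp only [complementDesign, mem_image, mem_subsetOrbit]
  constructor
  · rintro ⟨_, ⟨g, hg, rfl⟩, rfl⟩
    exact ⟨g, hg, by rw [smul_compl]⟩
  · rintro ⟨g, hg, rfl⟩
    exact ⟨_, ⟨g, hg, rfl⟩, by rw [smul_compl]⟩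

end Orbits

/-! ### Subsets of the 22 points as bit masks -/

/-- The subset of the 22 points given by the binary digits of `m`. -/
def ofMask (m : ℕ) : Finset (Fin 22) := univ.filter fun x => m.testBit x

/-- The mask of the image under `f` of the subset with mask `m`. -/
def imageMask (f : ℕ → ℕ) (m : ℕ) : ℕ :=
  (List.range 22).foldr (fun x s => bif m.testBit x then s ||| 1 <<< f x else s) 0

/-- The number of digits 1 among the lowest `n` binary digits of `m`. -/
def bitCount : ℕ → ℕ → ℕ
  | 0, _ => 0
  | n + 1, m => m % 2 + bitCount n (m / 2)

/-- The number of elements of the subset with mask `m`. -/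
def maskCard (m : ℕ) : ℕ := bitCount 22 m

theorem mem_ofMask {m : ℕ} {x : Fin 22} : x ∈ ofMask m ↔ m.testBit x = true := by
  simp [ofMask]

theorem testBit_imageMask (f : ℕ → ℕ) (m y : ℕ) :
    (imageMask f m).testBit y = true ↔ ∃ x < 22, m.testBit x = true ∧ f x = y := by
  have key : ∀ l : List ℕ,
      (l.foldr (fun x s => bif m.testBit x then s ||| 1 <<< f x else s) 0).testBit y = true ↔
        ∃ x ∈ l, m.testBit x = true ∧ f x = y := by
    intro l
    induction l with
    | nil => simp
    | cons a l ih =>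
      rw [List.foldr_cons]
      cases h : m.testBit a
      · simp [ih, h]
      · rw [cond_true, Nat.testBit_or, Bool.or_eq_true, ih, Nat.one_shiftLeft,
          Nat.testBit_two_pow, decide_eq_true_eq, or_comm]
        simp [h]
  exact (key (List.range 22)).trans (by simp)

theorem ofMask_imageMask {g : Equiv.Perm (Fin 22)} {f : ℕ → ℕ}
    (hf : ∀ x : Fin 22, f x = g x) (m : ℕ) : ofMask (imageMask f m) = g • ofMask m := by
  ext y
  rw [mem_ofMask, testBit_imageMask, mem_smul_finset]
  constructor
  · rintro ⟨x, hx, hm, hy⟩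
    exact ⟨⟨x, hx⟩, mem_ofMask.2 hm, Fin.ext (by rw [← hy]; exact (hf ⟨x, hx⟩).symm)⟩
  · rintro ⟨x, hx, rfl⟩
    exact ⟨x, x.2, mem_ofMask.1 hx, hf x⟩

theorem card_filter_fin (p : ℕ → Bool) :
    (univ.filter fun x : Fin 22 => p x = true).card = (List.range 22).countP p := by
  rw [Fin.univ_def, ← List.map_coe_finRange_eq_range, List.countP_map]
  simp only [Finset.card, Finset.filter, Multiset.filter_coe, Multiset.coe_card,
    List.countP_eq_length_filter]
  congr 2
  ext x
  simp

theorem bitCount_eq_countP (n m : ℕ) : bitCount n m = (List.range n).countP m.testBit := by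
  induction n generalizing m with
  | zero => rfl
  | succ n ih =>
    rw [bitCount, ih, List.range_succ_eq_map, List.countP_cons, List.countP_map, add_comm]
    congr 1
    · exact List.countP_congr fun i _ => by simp [Nat.testBit_succ]
    · rw [Nat.testBit_zero]
      rcases Nat.mod_two_eq_zero_or_one m with h | h <;> simp [h]

theorem card_ofMask (m : ℕ) : (ofMask m).card = maskCard m :=
  (card_filter_fin m.testBit).trans (bitCount_eq_countP 22 m).symm

theorem ofMask_inter (m n : ℕ) : ofMask m ∩ ofMask n = ofMask (m &&& n) := by
  ext x
  simp [mem_ofMask, Nat.testBit_and]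

theorem ofMask_or_shiftLeft (m : ℕ) (p : Fin 22) :
    ofMask (m ||| 1 <<< (p : ℕ)) = insert p (ofMask m) := by
  ext x
  simp only [mem_ofMask, Nat.testBit_or, Nat.one_shiftLeft, Nat.testBit_two_pow, Bool.or_eq_true,
    decide_eq_true_eq, mem_insert, Fin.ext_iff]
  rw [or_comm, eq_comm]

/-! ### Words in the generators -/

/-- Four permutations of the 22 points, tabulated with five binary digits per value: the identity,
and the products `a * b ^ d` of the generators for `d = 1, 2, 3`. -/
def letterTable : ℕ :=
  0x82ce898e2261414525cf248c1ab4c2984e3726447ad54044a86b2156a4ec98c144162252dee206b2342b49ca307b9ac5a928398a418820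

/-- The image of the point `x` under the `d`-th permutation of `letterTable`. -/
def letterFun (d x : ℕ) : ℕ := (letterTable >>> (5 * (22 * d + x))) % 32

/-- The permutation of which the digits of `w` to base 4 are a word in the letters `a * b ^ d`;
the lowest digit acts first, and only the lowest `n` digits are read. -/
def wordFun : ℕ → ℕ → ℕ → ℕ
  | 0, _, x => x
  | n + 1, w, x => wordFun n (w / 4) (letterFun (w % 4) x)

theorem exists_letterFun_eq : ∀ d < 4, ∃ g ∈ mathieu22, ∀ x : Fin 22, letterFun d x = g x := by
  have ha : mathieu22GenA ∈ mathieu22 := Subgroup.subset_closure (by simp)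
  have hb : mathieu22GenB ∈ mathieu22 := Subgroup.subset_closure (by simp)
  have h0 : ∀ x : Fin 22, letterFun 0 x = x := by decide +kernel
  have h : ∀ d : Fin 3, ∀ x : Fin 22,
      letterFun (d + 1) x = (mathieu22GenA * mathieu22GenB ^ (d + 1 : ℕ)) x := by
    decide +kernel
  intro d hd
  rcases d with _ | d
  · exact ⟨1, mathieu22.one_mem, h0⟩
  · exact ⟨_, mathieu22.mul_mem ha (mathieu22.pow_mem hb _), h ⟨d, by omega⟩⟩

theorem exists_wordFun_eq (n w : ℕ) :
    ∃ g ∈ mathieu22, ∀ x : Fin 22, wordFun n w x = g x := by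
  induction n generalizing w with
  | zero => exact ⟨1, mathieu22.one_mem, fun x => rfl⟩
  | succ n ih =>
    obtain ⟨g, hg, hgx⟩ := exists_letterFun_eq (w % 4) (Nat.mod_lt _ (by norm_num))
    obtain ⟨h, hh, hhx⟩ := ih (w / 4)
    refine ⟨h * g, mathieu22.mul_mem hh hg, fun x => ?_⟩
    rw [wordFun, hgx, hhx, Equiv.Perm.mul_apply]

theorem ofMask_imageMask_wordFun_mem (n w m : ℕ) :
    ofMask (imageMask (wordFun n w) m) ∈ subsetOrbit mathieu22 (ofMask m) := by
  obtain ⟨g, hg, h⟩ := exists_wordFun_eq n w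
  exact mem_subsetOrbit.2 ⟨g, hg, (ofMask_imageMask h m).symm⟩

/-! ### An invariant from a class of 176 heptads -/

/-- The masks of the 176 heptads in one of the two orbits of `M₂₂` of that length on
7-subsets. -/
def heptadMasks : List ℕ :=
  [499, 5798, 11370, 17709, 21112, 26804, 34331, 37198, 43906, 49861, 54672, 63497, 68452, 72753,
  78248, 90659, 101516, 106773, 112192, 116818, 133801, 141104, 143461, 153890, 167233, 170516,
  172248, 189446, 196670, 214240, 233603, 246536, 263068, 267465, 273925, 276816, 280386, 282647,
  296052, 299809, 311466, 329995, 337042, 350848, 352332, 395462, 406026, 412696, 418177, 459345,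
  464132, 501792, 527638, 531011, 532623, 543176, 549969, 553732, 569394, 577056, 591745, 594132,
  600600, 611338, 622697, 656972, 659737, 670848, 672402, 688548, 729410, 739333, 792620, 795360,
  821393, 828680, 868656, 885254, 918563, 970816, 1054874, 1057366, 1062147, 1067793, 1072196,
  1074824, 1083431, 1106272, 1115480, 1118733, 1124545, 1130886, 1147568, 1180821, 1184704,
  1190156, 1196107, 1217576, 1248770, 1273872, 1314208, 1318969, 1346120, 1355908, 1380450,
  1426433, 1458724, 1474834, 1573674, 1593505, 1606850, 1622044, 1647652, 1677568, 1706096,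
  1745409, 1835333, 1840656, 1861634, 2031752, 2100944, 2103685, 2106185, 2110492, 2116110,
  2126018, 2132280, 2139297, 2163783, 2167570, 2179225, 2190592, 2215972, 2229642, 2238483,
  2244948, 2250241, 2261602, 2299976, 2302596, 2367782, 2377825, 2399234, 2417168, 2426408,
  2458048, 2494640, 2523149, 2622005, 2626912, 2658952, 2664516, 2670851, 2689186, 2777128,
  2851856, 2883674, 2901124, 2961409, 3017472, 3145964, 3160608, 3163186, 3180292, 3182673,
  3252234, 3328128, 3342625, 3408515, 3428616, 3475476, 3548224, 3673097, 3678608, 3752512,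
  3805190]

/-- The heptads with masks in `heptadMasks`. -/
def heptads : Finset (Finset (Fin 22)) := heptadMasks.toFinset.image ofMask

theorem smul_heptads_of_forall {g : Equiv.Perm (Fin 22)} {f : ℕ → ℕ}
    (hf : ∀ x : Fin 22, f x = g x) (h : ∀ m ∈ heptadMasks, imageMask f m ∈ heptadMasks) :
    g • heptads = heptads := by
  refine eq_of_subset_of_card_le ?_ (card_smul_finset _ _).ge
  intro X hX
  obtain ⟨Y, hY, rfl⟩ := mem_smul_finset.1 hX
  obtain ⟨m, hm, rfl⟩ := mem_image.1 hY
  rw [← ofMask_imageMask hf]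
  exact mem_image_of_mem _ (List.mem_toFinset.2 (h m (List.mem_toFinset.1 hm)))

/-- The generators are tested on the heptads through the letters `a * b` and `a * b ^ 2`, which
generate the same group. -/
theorem smul_heptads {g : Equiv.Perm (Fin 22)} (hg : g ∈ mathieu22) : g • heptads = heptads := by
  have h1 : (mathieu22GenA * mathieu22GenB) • heptads = heptads :=
    smul_heptads_of_forall (f := letterFun 1) (by decide +kernel) (by decide +kernel)
  have h2 : (mathieu22GenA * mathieu22GenB ^ 2) • heptads = heptads :=
    smul_heptads_of_forall (f := letterFun 2) (by decide +kernel) (by decide +kernel)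
  have hle : mathieu22 ≤ MulAction.stabilizer (Equiv.Perm (Fin 22)) heptads := by
    have hb : mathieu22GenB ∈ MulAction.stabilizer (Equiv.Perm (Fin 22)) heptads := by
      have := mul_mem (inv_mem (MulAction.mem_stabilizer_iff.2 h1))
        (MulAction.mem_stabilizer_iff.2 h2)
      rwa [show (mathieu22GenA * mathieu22GenB)⁻¹ * (mathieu22GenA * mathieu22GenB ^ 2)
        = mathieu22GenB by group] at this
    have ha := mul_mem (MulAction.mem_stabilizer_iff.2 h1) (inv_mem hb)
    rw [mul_inv_cancel_right] at ha
    rw [mathieu22, Subgroup.closure_le]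
    rintro x (rfl | rfl)
    exacts [ha, hb]
  exact MulAction.mem_stabilizer_iff.1 (hle hg)

/-- The sum of the eighth powers of the intersection numbers of `X` with the heptads. Eight is the
least exponent for which this tells apart the orbits of `M₂₂` on `k`-subsets for all `k ≤ 11`. -/
def heptadMoment (X : Finset (Fin 22)) : ℕ := ∑ h ∈ heptads, (h ∩ X).card ^ 8

theorem heptadMoment_smul {g : Equiv.Perm (Fin 22)} (hg : g ∈ mathieu22) (X : Finset (Fin 22)) :
    heptadMoment (g • X) = heptadMoment X := by
  conv_lhs => rw [heptadMoment, ← smul_heptads hg]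
  rw [heptadMoment, smul_finset_def, sum_image (MulAction.injective g).injOn]
  refine sum_congr rfl fun h _ => ?_
  rw [← smul_finset_inter, card_smul_finset]

/-- `heptadMoment` of the subset with mask `m`. -/
def maskMoment (m : ℕ) : ℕ := (heptadMasks.map fun h => maskCard (h &&& m) ^ 8).sum

theorem ofMask_injOn : Set.InjOn ofMask {m | m < 2 ^ 22} := by
  intro m hm n hn h
  refine Nat.eq_of_testBit_eq fun i => ?_
  by_cases hi : i < 22
  · have := congrArg ((⟨i, hi⟩ : Fin 22) ∈ ·) h
    simpa [mem_ofMask] using this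
  · have hi' : 2 ^ 22 ≤ 2 ^ i := Nat.pow_le_pow_right (by norm_num) (by omega)
    rw [Nat.testBit_lt_two_pow (lt_of_lt_of_le hm hi'),
      Nat.testBit_lt_two_pow (lt_of_lt_of_le hn hi')]

theorem heptadMoment_ofMask (m : ℕ) : heptadMoment (ofMask m) = maskMoment m := by
  have hlt : ∀ m ∈ heptadMasks, m < 2 ^ 22 := by decide +kernel
  have hnd : heptadMasks.Nodup := by decide +kernel
  rw [heptadMoment, heptads, sum_image (ofMask_injOn.mono fun m hm => hlt m (by simpa using hm)),
    List.sum_toFinset _ hnd, maskMoment]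
  simp only [ofMask_inter, card_ofMask]

/-! ### Representatives of the orbits -/

/-- An entry of the table of orbits of `M₂₂` on `k`-subsets. -/
structure OrbitRep where
  /-- The mask of a subset in the orbit. -/
  mask : ℕ
  /-- The length of the orbit. -/
  size : ℕ
  /-- One code for each point: for a point `p` outside the subset, `16 * w + j` where `w` is a
  word that moves the subset with `p` adjoined to the `j`-th representative of the orbits on
  `(k + 1)`-subsets. The codes of the points inside the subset are not used. -/
  codes : List ℕ

namespace OrbitRep

/-- The represented subset. -/
def subset (R : OrbitRep) : Finset (Fin 22) := ofMask R.mask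

/-- The position in the table of the orbit of the subset with `p` adjoined. -/
def target (R : OrbitRep) (p : ℕ) : ℕ := R.codes.getD p 0 % 16

/-- The image of the subset with `p` adjoined under the word belonging to `p`. -/
def extension (R : OrbitRep) (p : ℕ) : ℕ :=
  imageMask (wordFun 13 (R.codes.getD p 0 / 16)) (R.mask ||| 1 <<< p)

/-- The number of points `p` that extend the subset to the `j`-th orbit on `(k + 1)`-subsets. -/
def extensionCount (R : OrbitRep) (j : ℕ) : ℕ :=
  (List.range 22).countP fun p => !R.mask.testBit p && R.target p == j

end OrbitRep

/-- The orbits of `M₂₂` on `k`-subsets for `k ≤ 11`. -/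
def orbitReps : ℕ → List OrbitRep
  | 0 =>
    [⟨0, 1, [0, 464, 1904, 496, 864, 3472, 112, 32, 208, 912, 224, 48, 3488, 848, 976, 16, 2000,
    160, 880, 144, 240, 480]⟩]
  | 1 =>
    [⟨1, 22, [0, 0, 8016, 10896, 10832, 1952, 55152, 14256, 3440, 25952, 1776, 15776, 32224,
    26544, 6512, 688, 10960, 59248, 43744, 15984, 43488, 8144]⟩]
  | 2 =>
    [⟨3, 231, [0, 0, 0, 1669008, 244128, 1441136, 251856, 7024, 112336, 104144, 54864, 63376,
    26224, 38864, 976864, 89760, 95904, 351136, 95840, 222704, 2672, 1669024]⟩]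
  | 3 =>
    [⟨7, 1540, [0, 0, 0, 0, 257952, 44000, 2513296, 4183408, 1, 43761, 383968, 43760, 2727264,
    176112, 192160, 353952, 95904, 44001, 190064, 355952, 4177824, 97904]⟩]
  | 4 =>
    [⟨15, 6160, [0, 0, 0, 0, 0, 10221920, 7693744, 1, 644768, 1677808, 12162784, 2844016,
    12148688, 425825, 2, 252818, 42338, 3503968, 12162528, 355953, 23567824, 5728112]⟩,
     ⟨263, 1155, [0, 0, 0, 644768, 694112, 14016224, 7821680, 11169232, 0, 3, 383968, 419424,
     2727264, 106080, 2614944, 908704, 24075104, 10067, 3513760, 1498000, 26705632, 2781024]⟩]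
  | 5 =>
    [⟨31, 18480, [0, 0, 0, 0, 0, 0, 1, 16374688, 2, 1701472, 94238320, 2844017, 14575504,
    65502608, 62864, 41310880, 28671392, 30916304, 39581392, 11426192, 1535474, 15653266]⟩,
     ⟨143, 3696, [0, 0, 0, 0, 16374688, 456592, 11954096, 0, 2856912, 628688, 6190688, 49276528,
     45021072, 3, 50314592, 58300400, 6780496, 49211120, 33021520, 169443, 226640, 12543312]⟩,
     ⟨16399, 3696, [0, 0, 0, 0, 62864, 44000, 10053584, 50314592, 49249168, 16358736, 1989984,
     3759008, 39163296, 383472, 0, 4, 155604, 2776800, 106064, 7241376, 91995552, 2463472]⟩,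
     ⟨775, 462, [0, 0, 0, 46561, 10335857, 8282065, 159121, 768865, 0, 0, 4155297, 186353,
     2727265, 6122961, 1011601, 1497489, 747425, 5, 1011089, 1498001, 3075569, 2989809]⟩]
  | 6 =>
    [⟨63, 55440, [0, 0, 0, 0, 0, 0, 0, 1, 29320865, 32370129, 2, 749008, 514512, 2713426, 62865,
    3110305, 3, 637843, 28933089, 11426193, 12432721, 32429472]⟩,
     ⟨95, 7392, [0, 0, 0, 0, 0, 0, 0, 6798800, 56485264, 1701472, 31047280, 4, 5693168, 11459488,
     30783056, 33536400, 1668704, 6789792, 127792880, 30785104, 1031920, 3070432]⟩,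
     ⟨287, 9240, [0, 0, 0, 0, 0, 29320865, 56485264, 44784625, 0, 3651504, 4155297, 115694928,
     1499025, 16227696, 62864, 7706449, 25147089, 41840624, 39581393, 14409329, 5, 382453]⟩,
     ⟨8335, 1232, [0, 0, 0, 0, 11132915, 456595, 1399187, 0, 1023379, 4062627, 1506259, 4190163,
     16365939, 0, 383475, 253939, 43619, 25097571, 43747, 6, 15595347, 11402227]⟩,
     ⟨49167, 1232, [0, 0, 0, 0, 62866, 10876754, 112018, 16642018, 8230386, 23459666, 9854962,
     7854434, 1965426, 4038546, 0, 0, 7, 40234466, 106066, 3530706, 56914, 2463474]⟩,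
     ⟨131847, 77, [0, 0, 0, 46564, 694116, 756, 159124, 768868, 0, 0, 21844, 89956, 55204, 164,
     22964, 996, 95908, 0, 5716, 4084, 458324, 97908]⟩]
  | 7 =>
    [⟨127, 55440, [0, 0, 0, 0, 0, 0, 0, 0, 56485264, 1, 2, 3, 4, 2713426, 7714708, 697810,
    29288160, 697808, 114933489, 12481940, 10854098, 697812]⟩,
     ⟨191, 73920, [0, 0, 0, 0, 0, 0, 0, 0, 5, 6, 3137378, 22376162, 753489, 5989733, 4025830,
     23033185, 6780496, 456597, 31823858, 5989728, 12432726, 697844]⟩,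
     ⟨1087, 18480, [0, 0, 0, 0, 0, 0, 2, 3137378, 27158245, 8222629, 0, 89515346, 225892178, 7,
     62869, 22673061, 10317285, 96434533, 175102290, 6150642, 505698, 66678674]⟩,
     ⟨65599, 18480, [0, 0, 0, 0, 0, 0, 29288160, 6780496, 694117, 424437, 10317285, 28965856,
     22441888, 702309, 4025829, 23986005, 0, 8, 9791072, 2733392, 12432720, 129742240]⟩,
     ⟨2143, 1232, [0, 0, 0, 0, 0, 3, 0, 257955, 5698899, 1701475, 14642899, 0, 1423267, 43763,
     30783059, 3660627, 1668707, 222691, 9895251, 14401395, 1031923, 645603]⟩,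
     ⟨1048863, 2640, [0, 0, 0, 0, 0, 22509169, 1031921, 613745, 0, 3651505, 9649, 10448785,
     22353, 16150417, 62865, 516065, 22920561, 10321649, 8279665, 7732897, 0, 9]⟩,
     ⟨532623, 176, [0, 0, 0, 0, 976600, 128600, 1399192, 0, 1023384, 350168, 1016, 15784, 245464,
     0, 43512, 253944, 43624, 236408, 43752, 0, 226648, 104056]⟩,
     ⟨114703, 176, [0, 0, 0, 0, 62871, 26535, 55655, 195063, 28023, 14247, 120295, 391671,
     1965431, 162775, 0, 0, 0, 786023, 106071, 712439, 56919, 15735]⟩]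
  | 8 =>
    [⟨255, 73920, [0, 0, 0, 0, 0, 0, 0, 0, 0, 1, 11954097, 2, 108424529, 3, 434468593, 58613153,
    4, 98547315, 897553905, 5871988, 11954099, 58613156]⟩,
     ⟨639, 36960, [0, 0, 0, 0, 0, 0, 0, 1, 175725937, 0, 114915313, 5, 167229809, 22527889,
     258455921, 190709153, 464936881, 697809, 6, 133677041, 1701473, 32370161]⟩,
     ⟨1151, 73920, [0, 0, 0, 0, 0, 0, 0, 11954097, 392626019, 114915313, 0, 4128226, 7, 8,
     468023025, 232373171, 29288163, 106648977, 8125281, 64723383, 10854103, 467252945]⟩,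
     ⟨2175, 9240, [0, 0, 0, 0, 0, 0, 0, 2, 22527378, 5, 4128226, 0, 1423269, 10484082, 749013,
     685474, 28965858, 222690, 44688981, 48805, 10901394, 645605]⟩,
     ⟨4223, 36960, [0, 0, 0, 0, 0, 0, 0, 108424529, 2080228, 167229809, 7, 1423269, 0, 501045201,
     32431092, 24532577, 176143761, 14046628, 233727953, 12481943, 260023, 753525]⟩,
     ⟨447, 55440, [0, 0, 0, 0, 0, 0, 0, 0, 0, 429242083, 91123619, 749016, 166704609, 9954803,
     45078995, 106358641, 49702227, 29320867, 89652707, 39827955, 368472049, 125261233]⟩,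
     ⟨703, 27720, [0, 0, 0, 0, 0, 0, 1, 0, 429242083, 0, 40298483, 64379761, 3644769, 41805809,
     9, 124708817, 129400657, 9960867, 9957201, 190242707, 628697, 32370129]⟩,
     ⟨9279, 2640, [0, 0, 0, 0, 0, 0, 8, 3137384, 628632, 386680, 0, 3110312, 14380760, 0,
     14137752, 15689304, 2879064, 4192632, 9793128, 106472, 505704, 10221928]⟩,
     ⟨196671, 2640, [0, 0, 0, 0, 0, 0, 697808, 456592, 621008, 424432, 10317280, 222688,
     22441888, 702304, 3499616, 23986000, 0, 0, 9791072, 2733392, 1535472, 2095056]⟩,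
     ⟨3146015, 330, [0, 0, 0, 0, 0, 423766, 179958, 179926, 0, 3651478, 9654, 2514870, 22358,
     1676694, 9622, 516070, 88406, 2471654, 1676726, 193894, 0, 0]⟩]
  | 9 =>
    [⟨511, 18480, [0, 0, 0, 0, 0, 0, 0, 0, 0, 0, 11954096, 1, 98541136, 98948816, 124099984,
    47539536, 44784624, 60536560, 43620048, 57636208, 106796496, 6676448]⟩,
     ⟨767, 221760, [0, 0, 0, 0, 0, 0, 0, 0, 0, 0, 2, 3, 242636386, 794146466, 4, 10911202,
     22799731, 5, 6, 22799730, 1701476, 41916754]⟩,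
     ⟨2303, 24640, [0, 0, 0, 0, 0, 0, 0, 0, 1, 3, 11954099, 0, 242636387, 7, 7821043, 14251475,
     64710307, 48807, 124612515, 48803, 1466279, 11200435]⟩,
     ⟨8447, 110880, [0, 0, 0, 0, 0, 0, 0, 0, 98948816, 794146466, 3141013, 7, 43775604, 0,
     976597, 45543138, 7171554, 8, 190705236, 23460688, 425832, 62633714]⟩,
     ⟨65791, 36960, [0, 0, 0, 0, 0, 0, 0, 0, 44784624, 22799731, 7714738, 64710307, 108424530,
     7171554, 242118578, 23033186, 0, 3496944, 10904915, 9, 12432722, 1685337]⟩,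
     ⟨2687, 18480, [0, 0, 0, 0, 0, 0, 0, 3, 45506003, 0, 43869651, 0, 56342963, 10484083,
     108353875, 685475, 45513379, 697811, 10, 427398515, 1701475, 124708851]⟩,
     ⟨262783, 4620, [0, 0, 0, 0, 0, 0, 0, 6, 43620054, 0, 8125286, 10, 10451350, 22396854,
     2727254, 22673062, 9791078, 56790, 0, 5593430, 1701478, 32370166]⟩,
     ⟨5247, 36960, [0, 0, 0, 0, 0, 0, 0, 11954098, 175728562, 127852530, 0, 14048211, 0,
     29219285, 492526930, 266715090, 27122133, 44802003, 196736850, 11, 260027, 132118451]⟩,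
     ⟨9343, 18480, [0, 0, 0, 0, 0, 0, 0, 3141013, 5993957, 16185717, 0, 4128225, 29219285, 0,
     124629, 458597, 11005333, 22797301, 8125285, 44529013, 27252181, 129351285]⟩,
     ⟨17087, 6160, [0, 0, 0, 0, 0, 0, 4, 0, 7953844, 0, 15186596, 64379764, 3644772, 127645556,
     0, 47967860, 125204468, 4025828, 39288788, 16366932, 12, 1564372]⟩]
  | 10 =>
    [⟨1023, 73920, [0, 0, 0, 0, 0, 0, 0, 0, 0, 0, 0, 1, 242636384, 2, 24616352, 4052642,
    22799729, 4052641, 3, 22799728, 166621008, 4052640]⟩,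
     ⟨2559, 6160, [0, 0, 0, 0, 0, 0, 0, 0, 0, 1, 11954097, 0, 31878753, 6806001, 261840849,
     14251473, 44784625, 124624337, 124612513, 48801, 106796497, 11200433]⟩,
     ⟨1791, 221760, [0, 0, 0, 0, 0, 0, 0, 0, 0, 0, 0, 4, 39546578, 5, 6, 260592, 7, 8, 107903894,
     9, 124100025, 41916792]⟩,
     ⟨2815, 110880, [0, 0, 0, 0, 0, 0, 0, 0, 1, 0, 4, 0, 179928804, 6809577, 260569, 169447, 10,
     10448273, 257962, 16145815, 10067353, 41916761]⟩,
     ⟨17151, 73920, [0, 0, 0, 0, 0, 0, 0, 0, 24616352, 0, 6, 260569, 250477392, 249255416, 0,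
     10911200, 96444073, 133093096, 39288790, 45870569, 11, 41916760]⟩,
     ⟨131839, 73920, [0, 0, 0, 0, 0, 0, 0, 0, 4052641, 0, 8, 10448273, 66043637, 43489256,
     133093096, 697816, 41377233, 0, 12, 22395752, 10876904, 9960869]⟩,
     ⟨262911, 27720, [0, 0, 0, 0, 0, 0, 0, 0, 3, 0, 107903894, 257962, 4085350, 165082614,
     39288790, 10911206, 5667178, 12, 0, 45870566, 3046886, 41916758]⟩,
     ⟨10495, 18480, [0, 0, 0, 0, 0, 0, 0, 0, 6806001, 6809577, 64743073, 0, 633044825, 0,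
     7821041, 45543145, 7171561, 13, 116366713, 43875313, 425837, 392526681]⟩,
     ⟨139519, 22176, [0, 0, 0, 0, 0, 0, 0, 0, 6676320, 43489256, 22797304, 13, 56097264, 0,
     127530600, 976304, 7171552, 0, 2058152, 669875104, 5748397, 966112856]⟩,
     ⟨590079, 7392, [0, 0, 0, 0, 0, 0, 0, 0, 14662130, 497508, 2864884, 48804, 7272034, 11459490,
     30916084, 16775522, 0, 31307426, 10904916, 0, 3129204, 14]⟩,
     ⟨264831, 2310, [0, 0, 0, 0, 0, 0, 0, 257962, 2876890, 0, 29292474, 0, 387066, 2864554,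
     7994730, 16496042, 44970, 11888106, 0, 11271082, 11949802, 3794938]⟩,
     ⟨529535, 7392, [0, 0, 0, 0, 0, 0, 0, 753495, 33406837, 49901493, 0, 3774039, 0, 2713429,
     49903991, 44398567, 2727541, 16147815, 2030245, 0, 15, 972375]⟩,
     ⟨1065663, 616, [0, 0, 0, 0, 0, 0, 11, 0, 62875, 0, 1023899, 1961707, 7035, 2078139, 0,
     3790235, 628699, 234875, 9957211, 490347, 0, 778075]⟩]
  | 11 =>
    [⟨2047, 110880, []⟩,
     ⟨3071, 73920, []⟩,
     ⟨9215, 36960, []⟩,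
     ⟨263167, 9240, []⟩,
     ⟨3839, 44352, []⟩,
     ⟨9983, 36960, []⟩,
     ⟨18175, 73920, []⟩,
     ⟨67327, 44352, []⟩,
     ⟨132863, 110880, []⟩,
     ⟨526079, 110880, []⟩,
     ⟨68351, 27720, []⟩,
     ⟨1065727, 7392, []⟩,
     ⟨393983, 9240, []⟩,
     ⟨141567, 7392, []⟩,
     ⟨2687231, 672, []⟩,
     ⟨1578111, 672, []⟩]
  | _ => []

/-- The masks of the representatives have `k` binary digits 1, and `heptadMoment` tells the
represented subsets apart. -/
theorem orbitReps_separated : ∀ k < 12, (∀ R ∈ orbitReps k, maskCard R.mask = k) ∧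
    ((orbitReps k).map fun R => maskMoment R.mask).Nodup := by
  decide +kernel

/-- The words in the table move the extensions of the representatives to representatives. -/
theorem extension_eq : ∀ k < 11, ∀ R ∈ orbitReps k, ∀ p < 22, R.mask.testBit p = false →
    (orbitReps (k + 1))[R.target p]?.map OrbitRep.mask = some (R.extension p) := by
  decide +kernel

/-- The orbit lengths in the table satisfy the recursion of
`IsOrbitTransversal.card_subsetOrbit_mul`. -/
theorem size_mul_eq : ∀ k < 11, ∀ j < (orbitReps (k + 1)).length,
    ((orbitReps (k + 1))[j]?.map OrbitRep.size).getD 0 * (k + 1) =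
      ((orbitReps k).map fun R => R.size * R.extensionCount j).sum := by
  decide +kernel

theorem subset_orbitReps_inj {k : ℕ} (hk : k < 12) {R S : OrbitRep} (hR : R ∈ orbitReps k)
    (hS : S ∈ orbitReps k) (h : S.subset ∈ subsetOrbit mathieu22 R.subset) : R = S := by
  obtain ⟨g, hg, h⟩ := mem_subsetOrbit.1 h
  refine List.inj_on_of_nodup_map (orbitReps_separated k hk).2 hR hS ?_
  rw [← heptadMoment_ofMask, ← heptadMoment_ofMask]
  exact (heptadMoment_smul hg _).symm.trans (congrArg heptadMoment h)

theorem card_subset_orbitReps {k : ℕ} (hk : k < 12) {R : OrbitRep} (hR : R ∈ orbitReps k) :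
    R.subset.card = k :=
  (card_ofMask _).trans ((orbitReps_separated k hk).1 R hR)

/-- Adjoining a point to a representative leads to the orbit named by `OrbitRep.target`. -/
theorem exists_subset_mem_subsetOrbit_insert {k : ℕ} (hk : k < 11) {R : OrbitRep}
    (hR : R ∈ orbitReps k) {p : Fin 22} (hp : p ∉ R.subset) :
    ∃ S, (orbitReps (k + 1))[R.target p]? = some S ∧
      S.subset ∈ subsetOrbit mathieu22 (insert p R.subset) := by
  have hp' : R.mask.testBit p = false := by
    rw [OrbitRep.subset, mem_ofMask] at hp
    simpa using hp
  have h := extension_eq k hk R hR p p.2 hp'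
  rw [Option.map_eq_some_iff] at h
  obtain ⟨S, hS, hm⟩ := h
  refine ⟨S, hS, ?_⟩
  rw [OrbitRep.subset, OrbitRep.subset, hm, ← ofMask_or_shiftLeft]
  exact ofMask_imageMask_wordFun_mem _ _ _

theorem isOrbitTransversal_orbitReps {k : ℕ} (hk : k < 12) :
    IsOrbitTransversal mathieu22 k ((orbitReps k).map OrbitRep.subset) := by
  have hinj : ∀ R ∈ orbitReps k, ∀ S ∈ orbitReps k, R.subset = S.subset → R = S :=
    fun R hR S hS h => subset_orbitReps_inj hk hR hS (h ▸ mem_subsetOrbit_self _)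
  refine ⟨(orbitReps_separated k hk).2.of_map.map_on fun R hR S hS h => hinj R hR S hS h,
    ?_, ?_, ?_⟩
  · simp only [List.mem_map]
    rintro _ ⟨R, hR, rfl⟩
    exact card_subset_orbitReps hk hR
  · simp only [List.mem_map, exists_exists_and_eq_and]
    clear hinj
    induction k with
    | zero =>
      intro Y hY
      refine ⟨_, List.mem_singleton_self _, ?_⟩
      rw [card_eq_zero.1 hY]
      convert mem_subsetOrbit_self (∅ : Finset (Fin 22))
      exact card_eq_zero.1 (card_ofMask 0)
    | succ k ih =>
      intro Y hY
      obtain ⟨p, Z, hpZ, rfl, hZ⟩ := card_eq_succ.1 hY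
      obtain ⟨R, hR, hRZ⟩ := ih (by omega) Z hZ
      obtain ⟨g, hg, rfl⟩ := mem_subsetOrbit.1 hRZ
      have hq : g⁻¹ p ∉ R.subset := fun h => hpZ (mem_smul_finset.2 ⟨_, h, by simp⟩)
      obtain ⟨S, hS, hSR⟩ := exists_subset_mem_subsetOrbit_insert (by omega) hR hq
      refine ⟨S, List.mem_of_getElem? hS, ?_⟩
      have hgi : insert p (g • R.subset) = g • insert (g⁻¹ p) R.subset := by
        rw [smul_finset_insert]
        simp
      rw [hgi, smul_mem_subsetOrbit_iff hg, subsetOrbit_eq_of_mem hSR]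
      exact mem_subsetOrbit_self _
  · simp only [List.mem_map]
    rintro _ ⟨R, hR, rfl⟩ _ ⟨S, hS, rfl⟩ h
    rw [subset_orbitReps_inj hk hR hS h]

theorem card_filter_insert_mem_subsetOrbit {k : ℕ} (hk : k < 11) {R S : OrbitRep}
    (hR : R ∈ orbitReps k) {j : ℕ} (hS : (orbitReps (k + 1))[j]? = some S) :
    (univ.filter fun p => p ∉ R.subset ∧ insert p R.subset ∈ subsetOrbit mathieu22 S.subset).card =
      R.extensionCount j := by
  rw [OrbitRep.extensionCount, ← card_filter_fin]
  congr 1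
  refine filter_congr fun p _ => ?_
  rw [Bool.and_eq_true, beq_iff_eq, Bool.not_eq_true', ← Bool.not_eq_true, ← mem_ofMask,
    ← OrbitRep.subset]
  refine and_congr_right fun hp => ?_
  obtain ⟨T, hT, hTR⟩ := exists_subset_mem_subsetOrbit_insert hk hR hp
  constructor
  · intro h
    rw [subsetOrbit_eq_of_mem h] at hTR
    obtain rfl := subset_orbitReps_inj (by omega) (List.mem_of_getElem? hS)
      (List.mem_of_getElem? hT) hTR
    have hnd := (orbitReps_separated (k + 1) (by omega)).2.of_map
    obtain ⟨hj, hj'⟩ := List.getElem?_eq_some_iff.1 hS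
    obtain ⟨ht, ht'⟩ := List.getElem?_eq_some_iff.1 hT
    exact (hnd.getElem_inj_iff).1 (ht'.trans hj'.symm)
  · rintro rfl
    obtain rfl : S = T := Option.some_injective _ (hS.symm.trans hT)
    rw [subsetOrbit_eq_of_mem hTR]
    exact mem_subsetOrbit_self _

theorem card_subsetOrbit_orbitReps {k : ℕ} (hk : k < 12) :
    ∀ R ∈ orbitReps k, (subsetOrbit mathieu22 R.subset).card = R.size := by
  induction k with
  | zero =>
    intro R hR
    obtain rfl := List.mem_singleton.1 hR
    refine card_eq_one.2 ⟨∅, ?_⟩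
    ext Y
    have h0 : ofMask 0 = ∅ := card_eq_zero.1 (card_ofMask 0)
    simp only [OrbitRep.subset, h0, mem_subsetOrbit, mem_singleton, smul_finset_empty]
    exact ⟨fun ⟨_, _, h⟩ => h.symm, fun h => ⟨1, one_mem _, h.symm⟩⟩
  | succ k ih =>
    intro S hS
    obtain ⟨j, hj⟩ := List.getElem?_of_mem hS
    have h := (isOrbitTransversal_orbitReps (k := k) (by omega)).card_subsetOrbit_mul
      (card_subset_orbitReps hk hS)
    have hsize := size_mul_eq k (by omega) j (List.getElem?_eq_some_iff.1 hj).1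
    rw [hj, Option.map_some, Option.getD_some] at hsize
    refine Nat.eq_of_mul_eq_mul_right k.succ_pos (h.trans (Eq.trans ?_ hsize.symm))
    rw [List.map_map]
    congr 1
    refine List.map_congr_left fun R hR => ?_
    rw [Function.comp_apply, ih (by omega) R hR,
      card_filter_insert_mem_subsetOrbit (by omega) hR hj]

/-! ### The classification -/

/-- `M₂₂` is transitive on `t`-subsets for `t ≤ 3`. -/
theorem exists_forall_mem_subsetOrbit {t : ℕ} (ht : t ≤ 3) :
    ∃ T₀ : Finset (Fin 22), ∀ T : Finset (Fin 22), T.card = t →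
      T ∈ subsetOrbit mathieu22 T₀ := by
  have h1 : ∀ t ≤ 3, (orbitReps t).length = 1 := by decide +kernel
  obtain ⟨R, hR⟩ := List.length_eq_one_iff.1 (h1 t ht)
  refine ⟨R.subset, fun T hT => ?_⟩
  obtain ⟨X, hX, hTX⟩ := (isOrbitTransversal_orbitReps (by omega)).exists_mem T hT
  rw [hR, List.map_singleton, List.mem_singleton] at hX
  rwa [← hX]

theorem isBlockTransitiveDesign_iff {k : ℕ} (hk : 3 ≤ k) {B : Finset (Finset (Fin 22))} :
    IsBlockTransitiveDesign mathieu22 k B ↔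
      ∃ X : Finset (Fin 22), X.card = k ∧ B = subsetOrbit mathieu22 X := by
  refine ⟨fun h => h.exists_eq_subsetOrbit, ?_⟩
  rintro ⟨X, rfl, rfl⟩
  obtain ⟨T₀, hT₀⟩ := exists_forall_mem_subsetOrbit le_rfl
  exact isBlockTransitiveDesign_subsetOrbit (by norm_num) hT₀ hk

/-- The parameters of the design formed by an orbit of `k`-subsets are determined by its
length. -/
theorem isThreeDesignWith_subsetOrbit {X : Finset (Fin 22)} {b r lam : ℕ}
    (hb : (subsetOrbit mathieu22 X).card = b) (hr : r * 22 = b * X.card)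
    (hlam : lam * 1540 = b * X.card.choose 3) :
    IsThreeDesignWith b r X.card lam (subsetOrbit mathieu22 X) := by
  have hk : ∀ Y ∈ subsetOrbit mathieu22 X, Y.card = X.card :=
    fun Y hY => card_of_mem_subsetOrbit hY
  obtain ⟨T₁, hT₁⟩ := exists_forall_mem_subsetOrbit (t := 1) (by norm_num)
  obtain ⟨T₃, hT₃⟩ := exists_forall_mem_subsetOrbit (t := 3) le_rfl
  obtain ⟨r', h1, hr'⟩ :=
    isTDesign_of_transitive le_rfl hT₁ (le_designAut_subsetOrbit X) hk
  obtain ⟨lam', h3, hlam'⟩ :=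
    isTDesign_of_transitive (by norm_num) hT₃ (le_designAut_subsetOrbit X) hk
  rw [hb, Fintype.card_fin, Nat.choose_one_right, Nat.choose_one_right] at hr'
  rw [hb, Fintype.card_fin, show Nat.choose 22 3 = 1540 by decide +kernel] at hlam'
  obtain rfl : r' = r := by omega
  obtain rfl : lam' = lam := by omega
  refine ⟨hb, fun x => ?_, h3⟩
  simpa using h1.card_through {x} (card_singleton x)

/-- Every orbit length in the table of orbits occurs in the table of parameters. -/
theorem exists_mem_designTable : ∀ k < 12, 4 ≤ k → ∀ R ∈ orbitReps k,
    ∃ q ∈ designTable, q.1 = R.size ∧ q.2.2.1 = k := by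
  decide +kernel

theorem designTable_arith : ∀ q ∈ designTable, (4 ≤ q.2.2.1 ∧ q.2.2.1 < 12) ∧
    q.2.1 * 22 = q.1 * q.2.2.1 ∧ q.2.2.2 * 1540 = q.1 * q.2.2.1.choose 3 := by
  decide +kernel

theorem exists_orbitRep_of_mem_designTable : ∀ q ∈ designTable,
    ∃ R ∈ orbitReps q.2.2.1, R.size = q.1 := by
  decide +kernel

theorem exists_isThreeDesignWith {k : ℕ} {B : Finset (Finset (Fin 22))} (hk : 4 ≤ k)
    (hk' : k ≤ 11) (hB : IsBlockTransitiveDesign mathieu22 k B) :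
    ∃ b r lam : ℕ, (b, r, k, lam) ∈ designTable ∧ IsThreeDesignWith b r k lam B := by
  obtain ⟨X, rfl, rfl⟩ := hB.exists_eq_subsetOrbit
  obtain ⟨Y, hY, hXY⟩ :=
    (isOrbitTransversal_orbitReps (k := X.card) (by omega)).exists_mem X rfl
  obtain ⟨R, hR, rfl⟩ := List.mem_map.1 hY
  obtain ⟨⟨b, r, k, lam⟩, hq, hb, hqk⟩ := exists_mem_designTable X.card (by omega) hk R hR
  obtain ⟨-, hr, hlam⟩ := designTable_arith _ hq
  simp only at hb hqk hr hlam
  subst hqk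
  refine ⟨b, r, lam, hq, isThreeDesignWith_subsetOrbit ?_ hr hlam⟩
  rw [subsetOrbit_eq_of_mem hXY, card_subsetOrbit_orbitReps (by omega) R hR, hb]

theorem exists_of_mem_designTable {b r k lam : ℕ} (hq : (b, r, k, lam) ∈ designTable) :
    ∃ B : Finset (Finset (Fin 22)),
      IsBlockTransitiveDesign mathieu22 k B ∧ IsThreeDesignWith b r k lam B := by
  obtain ⟨⟨hk, hk'⟩, hr, hlam⟩ := designTable_arith _ hq
  obtain ⟨R, hR, hb⟩ := exists_orbitRep_of_mem_designTable _ hq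
  simp only at hk hk' hr hlam hR hb
  have hc := card_subset_orbitReps hk' hR
  refine ⟨subsetOrbit mathieu22 R.subset,
    (isBlockTransitiveDesign_iff (by omega)).2 ⟨_, hc, rfl⟩, ?_⟩
  have h := isThreeDesignWith_subsetOrbit (X := R.subset) (b := b) (r := r) (lam := lam)
  rw [hc] at h
  exact h ((card_subsetOrbit_orbitReps hk' R hR).trans hb) hr hlam

theorem complementDesign_complementDesign (B : Finset (Finset (Fin 22))) :
    complementDesign (complementDesign B) = B := by
  simp [complementDesign]

/-- Complementation exchanges block-transitive designs with block sizes `k` and `22 - k`. -/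
theorem IsBlockTransitiveDesign.complementDesign {k : ℕ} (hk : 3 ≤ 22 - k)
    {B : Finset (Finset (Fin 22))} (hB : IsBlockTransitiveDesign mathieu22 k B) :
    IsBlockTransitiveDesign mathieu22 (22 - k) (complementDesign B) := by
  obtain ⟨X, hX, rfl⟩ := hB.exists_eq_subsetOrbit
  rw [complementDesign_subsetOrbit]
  exact (isBlockTransitiveDesign_iff hk).2 ⟨_, by rw [card_compl, Fintype.card_fin, hX], rfl⟩

theorem subsetOrbit_eq_powersetCard {k : ℕ} (hk : 19 ≤ k) {X : Finset (Fin 22)}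
    (hX : X.card = k) : subsetOrbit mathieu22 X = powersetCard k univ := by
  obtain ⟨T₀, hT₀⟩ := exists_forall_mem_subsetOrbit (t := 22 - k) (by omega)
  have hT : ∀ Y : Finset (Fin 22), Y.card = k → Yᶜ ∈ subsetOrbit mathieu22 T₀ :=
    fun Y hY => hT₀ _ (by rw [card_compl, Fintype.card_fin, hY])
  ext Y
  rw [mem_powersetCard]
  refine ⟨fun h => ⟨subset_univ _, (card_of_mem_subsetOrbit h).trans hX⟩, fun h => ?_⟩
  have h2 := hT Y h.2
  rw [← subsetOrbit_eq_of_mem (hT X hX), ← complementDesign_subsetOrbit] at h2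
  obtain ⟨Z, hZ, hZY⟩ := mem_image.1 h2
  rwa [← compl_injective hZY]

theorem mainTheorem4 :
    -- every block-transitive design with block size 4, ..., 11 appears in the table
    (∀ (k : ℕ) (B : Finset (Finset (Fin 22))), 4 ≤ k → k ≤ 11 →
      IsBlockTransitiveDesign mathieu22 k B →
      ∃ b r lam : ℕ, (b, r, k, lam) ∈ designTable ∧ IsThreeDesignWith b r k lam B) ∧
    -- every row of the table is realised
    (∀ b r k lam : ℕ, (b, r, k, lam) ∈ designTable →
      ∃ B : Finset (Finset (Fin 22)),
        IsBlockTransitiveDesign mathieu22 k B ∧ IsThreeDesignWith b r k lam B) ∧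
    -- for block size 12, ..., 18 the designs are exactly the complements of those in the table
    (∀ (k : ℕ) (B : Finset (Finset (Fin 22))), 12 ≤ k → k ≤ 18 →
      (IsBlockTransitiveDesign mathieu22 k B ↔
        ∃ (C : Finset (Finset (Fin 22))) (b r lam : ℕ),
          (b, r, 22 - k, lam) ∈ designTable ∧
          IsBlockTransitiveDesign mathieu22 (22 - k) C ∧
          IsThreeDesignWith b r (22 - k) lam C ∧
          B = complementDesign C)) ∧
    -- for larger block size there is only the complete design
    (∀ (k : ℕ) (B : Finset (Finset (Fin 22))), 19 ≤ k → k ≤ 22 →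
      (IsBlockTransitiveDesign mathieu22 k B ↔
        B = Finset.powersetCard k Finset.univ)) := by
  refine ⟨fun k B => exists_isThreeDesignWith, fun b r k lam => exists_of_mem_designTable,
    fun k B hk hk' => ⟨fun hB => ?_, ?_⟩, fun k B hk hk' => ⟨fun hB => ?_, fun hB => ?_⟩⟩
  · have hC := hB.complementDesign (by omega)
    obtain ⟨b, r, lam, hq, hd⟩ := exists_isThreeDesignWith (by omega) (by omega) hC
    exact ⟨_, b, r, lam, hq, hC, hd, (complementDesign_complementDesign B).symm⟩
  · rintro ⟨C, b, r, lam, -, hC, -, rfl⟩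
    have := hC.complementDesign (by omega)
    rwa [Nat.sub_sub_self (by omega)] at this
  · obtain ⟨X, hX, rfl⟩ := hB.exists_eq_subsetOrbit
    exact subsetOrbit_eq_powersetCard hk hX
  · obtain ⟨X, -, hX⟩ := exists_subset_card_eq (s := (univ : Finset (Fin 22))) (n := k)
      (by simpa using hk')
    exact (isBlockTransitiveDesign_iff (by omega)).2
      ⟨X, hX, hB.trans (subsetOrbit_eq_powersetCard hk hX).symm⟩
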